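/- Let $\mathrm{PL}_o(I)$ be the group, under composition, of all orientation-preserving piecewise-linear homeomorphisms of the unit interval $I=[0,1]$ that have only finitely many breaks in slope. For groups $C$ and $T$, let $C\wr T$ denote the standard restricted wreath product $\bigl(\bigoplus_{t\in T} C\bigr)\rtimes T$, that is, the group of pairs $(\varphi,t)$ with $t\in T$ and $\varphi:T\to C$ of finite support, where $T$ acts on the functions $\varphi$ through its regular action on itself by translation. **Theorem 1.2.** Let $C$ and $T$ be nontrivial groups. If some subgroup $H$ of $\mathrm{PL}_o(I)$ is isomorphic to $C\wr T$, then $T\cong\mathbf Z$. -/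

import Mathlib

/-- A self-map `f` of the unit interval is *finitely piecewise affine*: there is a finite set `B`
of points such that `f` is affine on every interval having no point of `B` in its interior. -/
def IsFinitelyPiecewiseAffine (f : unitInterval → unitInterval) : Prop :=
  ∃ B : Set unitInterval, B.Finite ∧
    ∀ x y : unitInterval, x < y → Disjoint B (Set.Ioo x y) →
      ∃ m c : ℝ, ∀ z ∈ Set.Icc x y, (f z : ℝ) = m * (z : ℝ) + c

theorem IsFinitelyPiecewiseAffine.id :
    IsFinitelyPiecewiseAffine (fun x : unitInterval => x) :=
  ⟨∅, Set.finite_empty, fun _ _ _ _ => ⟨1, 0, fun z _ => by ring⟩⟩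

theorem IsFinitelyPiecewiseAffine.comp {f g : unitInterval → unitInterval}
    (hf : IsFinitelyPiecewiseAffine f) (hg : IsFinitelyPiecewiseAffine g)
    (hmono : StrictMono g) : IsFinitelyPiecewiseAffine (fun x => f (g x)) := by
  obtain ⟨B, hB, hfB⟩ := hf
  obtain ⟨D, hD, hgD⟩ := hg
  refine ⟨D ∪ g ⁻¹' B, hD.union (hB.preimage hmono.injective.injOn), fun x y hxy hdis => ?_⟩
  obtain ⟨m, c, hm⟩ := hgD x y hxy (hdis.mono_left Set.subset_union_left)
  -- a point of `B` between `g x` and `g y` has a preimage between `x` and `y`,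
  -- because `g` is affine there
  have hsurj : ∀ w : unitInterval, w ∈ Set.Ioo (g x) (g y) → ∃ z ∈ Set.Ioo x y, g z = w := by
    intro w hw
    have hgx := hm x ⟨le_refl x, hxy.le⟩
    have hgy := hm y ⟨hxy.le, le_refl y⟩
    have h1 : (g x : ℝ) < w := hw.1
    have h2 : (w : ℝ) < g y := hw.2
    have hxy' : (x : ℝ) < y := hxy
    have hmpos : 0 < m := by
      by_contra hneg
      nlinarith
    have hxz : (x : ℝ) < ((w : ℝ) - c) / m := by
      rw [lt_div_iff₀ hmpos]; linarith
    have hzy : ((w : ℝ) - c) / m < (y : ℝ) := by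
      rw [div_lt_iff₀ hmpos]; linarith
    let z : unitInterval := ⟨((w : ℝ) - c) / m, x.2.1.trans hxz.le, hzy.le.trans y.2.2⟩
    have hz : z ∈ Set.Ioo x y := ⟨hxz, hzy⟩
    refine ⟨z, hz, Subtype.ext ?_⟩
    rw [hm z ⟨hz.1.le, hz.2.le⟩]
    change m * (((w : ℝ) - c) / m) + c = w
    field_simp
    ring
  have hdis' : Disjoint B (Set.Ioo (g x) (g y)) := by
    rw [Set.disjoint_left]
    intro w hwB hw
    obtain ⟨z, hz, rfl⟩ := hsurj w hw
    exact Set.disjoint_left.mp hdis (Or.inr hwB) hz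
  obtain ⟨m', c', hm'⟩ := hfB (g x) (g y) (hmono hxy) hdis'
  refine ⟨m' * m, m' * c + c', fun z hz => ?_⟩
  rw [hm' (g z) ⟨hmono.monotone hz.1, hmono.monotone hz.2⟩, hm z hz]
  ring

theorem Homeomorph.strictMono_symm_of_strictMono {f : unitInterval ≃ₜ unitInterval}
    (hf : StrictMono f) : StrictMono f.symm := by
  intro x y hxy
  rw [← hf.lt_iff_lt, f.apply_symm_apply, f.apply_symm_apply]
  exact hxy

theorem IsFinitelyPiecewiseAffine.symm {f : unitInterval ≃ₜ unitInterval}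
    (hf : IsFinitelyPiecewiseAffine f) (hmono : StrictMono f) :
    IsFinitelyPiecewiseAffine f.symm := by
  obtain ⟨B, hB, hfB⟩ := hf
  have hs := Homeomorph.strictMono_symm_of_strictMono hmono
  refine ⟨f '' B, hB.image f, fun x y hxy hdis => ?_⟩
  have hdis' : Disjoint B (Set.Ioo (f.symm x) (f.symm y)) := by
    rw [Set.disjoint_left]
    intro b hb hbI
    refine Set.disjoint_left.mp hdis (Set.mem_image_of_mem f hb) ⟨?_, ?_⟩
    · have := hmono hbI.1
      rwa [f.apply_symm_apply] at this
    · have := hmono hbI.2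
      rwa [f.apply_symm_apply] at this
  obtain ⟨m, c, hm⟩ := hfB _ _ (hs hxy) hdis'
  have hval : ∀ z ∈ Set.Icc x y, (z : ℝ) = m * (f.symm z : ℝ) + c := by
    intro z hz
    have := hm (f.symm z) ⟨hs.monotone hz.1, hs.monotone hz.2⟩
    rwa [f.apply_symm_apply] at this
  have hm0 : m ≠ 0 := by
    rintro rfl
    have h1 := hval x ⟨le_refl x, hxy.le⟩
    have h2 := hval y ⟨hxy.le, le_refl y⟩
    have h3 : (x : ℝ) < y := hxy
    linarith
  refine ⟨m⁻¹, -(m⁻¹ * c), fun z hz => ?_⟩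
  rw [hval z hz]
  field_simp
  ring

/-- `PL_o(I)`: the group, under composition, of the orientation-preserving piecewise-linear
homeomorphisms of the unit interval that have only finitely many breaks in slope. -/
def PLo : Subgroup (unitInterval ≃ₜ unitInterval) where
  carrier := {f | StrictMono f ∧ IsFinitelyPiecewiseAffine f}
  one_mem' := ⟨strictMono_id, IsFinitelyPiecewiseAffine.id⟩
  mul_mem' := fun {_ _} ha hb => ⟨ha.1.comp hb.1, ha.2.comp hb.2 hb.1⟩
  inv_mem' := fun {_} ha => ⟨Homeomorph.strictMono_symm_of_strictMono ha.1, ha.2.symm ha.1⟩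

/-- The standard restricted wreath product `C ≀ T`, as the subgroup of the unrestricted regular
wreath product `C ≀ᵣ T` (functions `T → C`, extended by `T` acting by translation) consisting of
the pairs `⟨φ, t⟩` with `φ : T → C` of finite support. -/
def restrictedWreathSubgroup (C T : Type*) [Group C] [Group T] :
    Subgroup (RegularWreathProduct C T) where
  carrier := {a | (Function.mulSupport a.left).Finite}
  one_mem' := by simp
  mul_mem' := by
    intro a b ha hb
    have hb' : (Function.mulSupport fun x => b.left (a.right⁻¹ * x)).Finite :=
      Set.Finite.preimage (f := fun x => a.right⁻¹ * x) (mul_right_injective a.right⁻¹).injOn hb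
    exact (ha.union hb').subset (Function.mulSupport_mul _ _)
  inv_mem' := by
    intro a ha
    have ha' : (Function.mulSupport a.left⁻¹).Finite := by
      rw [Function.mulSupport_inv]; exact ha
    exact Set.Finite.preimage (f := fun x => a.right * x) (mul_right_injective a.right).injOn ha'

/-- The standard restricted wreath product `C ≀ T` of two groups. -/
abbrev RestrictedWreathProduct (C T : Type*) [Group C] [Group T] : Type _ :=
  restrictedWreathSubgroup C T

/-! # Wreath products among piecewise-linear homeomorphisms of the interval

Regard `T` as a subgroup of `PLo`, normalizing an abelian group `A` of piecewise-linear
homeomorphisms in which no nontrivial element is centralized by a nontrivial element of `T`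
(finitely supported functions from `T` to a cyclic subgroup of `C`). Fix `a ∈ A` with `a ≠ 1`.

A piecewise-linear homeomorphism has finitely many orbitals (components of its support), so
commuting ones preserve each other's orbitals, and orbitals that meet are equal. Hence the
translates by `T` of an orbital of `a` are pairwise equal or disjoint. If `c ∈ T` preserves an
orbital of `b ∈ A`, then `c * b * c⁻¹` agrees with `b` on it, since both have the same linear germ
at the left endpoint (`PLo.conj_smul_eq`).

Suppose that for every orbital of `a`, any finite set of its translates is preserved by a common
nontrivial element of `T`. Starting with `b = a` and replacing `b` by `b⁻¹ * (c * b * c⁻¹)` for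
suitable `c ∈ T`, one class of orbitals after another disappears from the support while `b` stays
nontrivial, which is absurd (`eq_one_of_supported`). So some orbital `O` of `a` fails this
condition. But if `T` is not abelian, a commutator is trivial near the left end of the `T`-orbital
containing `O`, and its conjugates are trivial up to any prescribed point
(`PLo.exists_ne_one_fixing_initial`), which gives the condition for `O`. Therefore `T` is abelian,
and then the failure of the condition means that `O` is disjoint from all its translates by
nontrivial elements of `T` (`exists_wandering_orbital`).

Finally, the slope at the left endpoint of the `T`-orbital of `O` embeds `T` in the positive reals.
A contraction in `T` carries `O` towards that endpoint without changing the ratio of the distances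
of its ends from the endpoint; a slope too close to `1` would make a translate of `O` meet its
image. So the slopes form a discrete, hence infinite cyclic, group
(`nonempty_mulEquiv_int_of_wandering`). -/

/-! ### Orbitals of groups acting on a linear order -/

section Orbitals

variable {G α : Type*} [Group G] [LinearOrder α] [MulAction G α]

/-- The orbital of `x` under a subgroup `K` acting by order automorphisms of a linear order: the
convex hull of the `K`-orbit of `x`. It is a singleton exactly when `K` fixes `x`, so these sets
partition the whole order, and the classical orbitals are the ones with more than one point. -/
def orbital (K : Subgroup G) (x : α) : Set α :=
  {y | ∃ g ∈ K, ∃ h ∈ K, g • x ≤ y ∧ y ≤ h • x}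

theorem smul_mem_orbital {K : Subgroup G} {k : G} (hk : k ∈ K) (x : α) :
    k • x ∈ orbital K x :=
  ⟨k, hk, k, hk, le_rfl, le_rfl⟩

theorem mem_orbital_self (K : Subgroup G) (x : α) : x ∈ orbital K x := by
  simpa using smul_mem_orbital K.one_mem x

theorem orbital_convex {K : Subgroup G} {x y z w : α} (hy : y ∈ orbital K x)
    (hz : z ∈ orbital K x) (h1 : y ≤ w) (h2 : w ≤ z) : w ∈ orbital K x := by
  obtain ⟨g, hg, -, -, hgy, -⟩ := hy
  obtain ⟨-, -, h, hh, -, hhz⟩ := hz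
  exact ⟨g, hg, h, hh, hgy.trans h1, h2.trans hhz⟩

theorem eq_of_mem_orbital_of_fixed {K : Subgroup G} {x y : α} (hx : ∀ k ∈ K, k • x = x)
    (hy : y ∈ orbital K x) : y = x := by
  obtain ⟨g, hg, h, hh, h1, h2⟩ := hy
  rw [hx g hg] at h1
  rw [hx h hh] at h2
  exact le_antisymm h2 h1

theorem eq_of_mem_orbital_zpowers_of_fixed {f : G} {x y : α} (hx : f • x = x)
    (hy : y ∈ orbital (Subgroup.zpowers f) x) : y = x := by
  refine eq_of_mem_orbital_of_fixed (fun k hk => ?_) hy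
  obtain ⟨n, rfl⟩ := Subgroup.mem_zpowers_iff.1 hk
  exact MulAction.mem_stabilizer_iff.1
    (Subgroup.zpow_mem (MulAction.stabilizer G x) (MulAction.mem_stabilizer_iff.2 hx) n)

variable [CovariantClass G α HSMul.hSMul LE.le]

theorem smul_le_smul_iff_of_group {g : G} {x y : α} : g • x ≤ g • y ↔ x ≤ y := by
  refine ⟨fun h => ?_, fun h => smul_le_smul_left g h⟩
  simpa using smul_le_smul_left g⁻¹ h

theorem smul_lt_smul_iff_of_group {g : G} {x y : α} : g • x < g • y ↔ x < y := by
  rw [← not_le, ← not_le, smul_le_smul_iff_of_group]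

theorem mem_orbital_symm {K : Subgroup G} {x y : α} (hy : y ∈ orbital K x) :
    x ∈ orbital K y := by
  obtain ⟨g, hg, h, hh, h1, h2⟩ := hy
  refine ⟨h⁻¹, K.inv_mem hh, g⁻¹, K.inv_mem hg, ?_, ?_⟩
  · simpa using smul_le_smul_left h⁻¹ h2
  · simpa using smul_le_smul_left g⁻¹ h1

theorem mem_orbital_trans {K : Subgroup G} {x y z : α} (hy : y ∈ orbital K x)
    (hz : z ∈ orbital K y) : z ∈ orbital K x := by
  obtain ⟨g, hg, h, hh, h1, h2⟩ := hy
  obtain ⟨g', hg', h', hh', h1', h2'⟩ := hz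
  refine ⟨g' * g, K.mul_mem hg' hg, h' * h, K.mul_mem hh' hh, ?_, ?_⟩
  · rw [mul_smul]; exact (smul_le_smul_left g' h1).trans h1'
  · rw [mul_smul]; exact h2'.trans (smul_le_smul_left h' h2)

theorem orbital_eq_of_mem {K : Subgroup G} {x y : α} (hy : y ∈ orbital K x) :
    orbital K y = orbital K x :=
  Set.ext fun _ => ⟨mem_orbital_trans hy, mem_orbital_trans (mem_orbital_symm hy)⟩

theorem smul_mem_orbital_of_mem {K : Subgroup G} {k : G} (hk : k ∈ K) {x y : α}
    (hy : y ∈ orbital K x) : k • y ∈ orbital K x :=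
  mem_orbital_trans hy (smul_mem_orbital hk y)

theorem smul_ne_of_mem_orbital {f : G} {x y : α} (hx : f • x ≠ x)
    (hy : y ∈ orbital (Subgroup.zpowers f) x) : f • y ≠ y := by
  intro h
  have := eq_of_mem_orbital_zpowers_of_fixed h (mem_orbital_symm hy)
  exact hx (this ▸ h)

theorem mem_orbital_zpowers_conj {f c : G} {x y : α}
    (hy : y ∈ orbital (Subgroup.zpowers f) x) :
    c • y ∈ orbital (Subgroup.zpowers (c * f * c⁻¹)) (c • x) := by
  obtain ⟨g, hg, h, hh, h1, h2⟩ := hy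
  obtain ⟨m, rfl⟩ := Subgroup.mem_zpowers_iff.1 hg
  obtain ⟨n, rfl⟩ := Subgroup.mem_zpowers_iff.1 hh
  refine ⟨_, Subgroup.zpow_mem_zpowers _ m, _, Subgroup.zpow_mem_zpowers _ n, ?_, ?_⟩
  · rw [conj_zpow]; simpa [mul_smul] using smul_le_smul_left c h1
  · rw [conj_zpow]; simpa [mul_smul] using smul_le_smul_left c h2

theorem smul_eq_self_of_pow_smul_eq {g : G} {x : α} {n : ℕ} (hn : n ≠ 0)
    (h : g ^ n • x = x) : g • x = x := by
  by_contra hne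
  rcases lt_or_gt_of_ne hne with hlt | hlt
  · have key : ∀ m : ℕ, g ^ (m + 1) • x < x := by
      intro m
      induction m with
      | zero => simpa using hlt
      | succ m ih =>
        rw [pow_succ', mul_smul]
        exact (smul_lt_smul_iff_of_group.2 ih).trans hlt
    obtain ⟨m, rfl⟩ := Nat.exists_eq_succ_of_ne_zero hn
    exact (key m).ne h
  · have key : ∀ m : ℕ, x < g ^ (m + 1) • x := by
      intro m
      induction m with
      | zero => simpa using hlt
      | succ m ih =>
        rw [pow_succ', mul_smul]
        exact hlt.trans (smul_lt_smul_iff_of_group.2 ih)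
    obtain ⟨m, rfl⟩ := Nat.exists_eq_succ_of_ne_zero hn
    exact (key m).ne' h

/-- A finite set meeting every nontrivial orbital of `f`; so `f` has finitely many of them. -/
def HasOrbitalReps (f : G) (D : Finset α) : Prop :=
  ∀ x : α, f • x ≠ x → ∃ d ∈ D, d ∈ orbital (Subgroup.zpowers f) x

/-- An order automorphism commuting with `f` permutes the finitely many nontrivial orbitals of `f`
monotonically, hence trivially. -/
theorem smul_mem_orbital_of_commute {f g : G} {D : Finset α} (hD : HasOrbitalReps f D)
    (hfg : Commute f g) {x : α} (hx : f • x ≠ x) :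
    g • x ∈ orbital (Subgroup.zpowers f) x := by
  have hmove : ∀ n : ℕ, f • g ^ n • x ≠ g ^ n • x := by
    intro n h
    rw [← mul_smul, (hfg.pow_right n).eq, mul_smul] at h
    exact hx (smul_left_cancel _ h)
  choose d hdD hd using fun n : ℕ => hD _ (hmove n)
  obtain ⟨m, n, hmn, he⟩ : ∃ m n : ℕ, m < n ∧ d m = d n := by
    obtain ⟨m, n, hne, he⟩ := Finite.exists_ne_map_eq_of_infinite
      (fun n : ℕ => (⟨d n, hdD n⟩ : D))
    have he' : d m = d n := congrArg Subtype.val he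
    rcases lt_or_gt_of_ne hne with h | h
    · exact ⟨m, n, h, he'⟩
    · exact ⟨n, m, h, he'.symm⟩
  have h1 : g ^ n • x ∈ orbital (Subgroup.zpowers f) (g ^ m • x) := by
    refine mem_orbital_trans (hd m) (mem_orbital_symm ?_)
    rw [he]; exact hd n
  have h2 := mem_orbital_zpowers_conj (c := (g ^ m)⁻¹) h1
  have h3 : (g ^ m)⁻¹ * f * (g ^ m)⁻¹⁻¹ = f := by
    rw [inv_inv, mul_assoc, (hfg.pow_right m).eq, inv_mul_cancel_left]
  rw [h3, inv_smul_smul] at h2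
  obtain ⟨k, rfl⟩ := Nat.exists_eq_add_of_lt hmn
  have h4 : g ^ (k + 1) • x ∈ orbital (Subgroup.zpowers f) x := by
    rwa [add_assoc, pow_add, mul_smul, inv_smul_smul] at h2
  rcases le_total x (g • x) with hle | hle
  · refine orbital_convex (mem_orbital_self _ _) h4 hle ?_
    rw [pow_succ', mul_smul]
    refine smul_le_smul_left g ?_
    clear h4 h2 h1 hmn he
    induction k with
    | zero => simp
    | succ k ih => rw [pow_succ', mul_smul]; exact hle.trans (smul_le_smul_left g ih)
  · refine orbital_convex h4 (mem_orbital_self _ _) ?_ hle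
    rw [pow_succ', mul_smul]
    refine smul_le_smul_left g ?_
    clear h4 h2 h1 hmn he
    induction k with
    | zero => simp
    | succ k ih => rw [pow_succ', mul_smul]; exact (smul_le_smul_left g ih).trans hle

theorem orbital_zpowers_subset_of_commute {f g : G} {D : Finset α} (hD : HasOrbitalReps f D)
    (hfg : Commute f g) {x : α} (hx : f • x ≠ x) :
    orbital (Subgroup.zpowers g) x ⊆ orbital (Subgroup.zpowers f) x := by
  rintro y ⟨g', hg', h', hh', h1, h2⟩
  obtain ⟨m, rfl⟩ := Subgroup.mem_zpowers_iff.1 hg'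
  obtain ⟨n, rfl⟩ := Subgroup.mem_zpowers_iff.1 hh'
  exact orbital_convex (smul_mem_orbital_of_commute hD (hfg.zpow_right m) hx)
    (smul_mem_orbital_of_commute hD (hfg.zpow_right n) hx) h1 h2

/-- Nontrivial orbitals of commuting elements are equal as soon as they meet. -/
theorem orbital_zpowers_eq_of_commute {f g : G} {D E : Finset α} (hD : HasOrbitalReps f D)
    (hE : HasOrbitalReps g E) (hfg : Commute f g) {x : α} (hx : f • x ≠ x) (hx' : g • x ≠ x) :
    orbital (Subgroup.zpowers g) x = orbital (Subgroup.zpowers f) x :=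
  (orbital_zpowers_subset_of_commute hD hfg hx).antisymm
    (orbital_zpowers_subset_of_commute hE hfg.symm hx')

/-- On a nontrivial orbital of `f`, an element commuting with `f` and having a fixed point is
trivial. -/
theorem smul_eq_self_of_commute_of_fixed {f g : G} {D E : Finset α} (hD : HasOrbitalReps f D)
    (hE : HasOrbitalReps g E) (hfg : Commute f g) {x y : α} (hx : f • x ≠ x)
    (hy : y ∈ orbital (Subgroup.zpowers f) x) (hgy : g • y = y) : g • x = x := by
  by_contra hgx
  rw [← orbital_zpowers_eq_of_commute hD hE hfg hx hgx] at hy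
  exact smul_ne_of_mem_orbital hgx hy hgy

theorem smul_mem_orbital_of_commute_conj {f c : G} {D E : Finset α} (hD : HasOrbitalReps f D)
    (hE : HasOrbitalReps (c * f * c⁻¹) E) (hfc : Commute f (c * f * c⁻¹)) {x y : α}
    (hx : f • x ≠ x) (hcx : c • x ∈ orbital (Subgroup.zpowers f) x)
    (hy : y ∈ orbital (Subgroup.zpowers f) x) :
    c • y ∈ orbital (Subgroup.zpowers f) x := by
  have h1 := mem_orbital_zpowers_conj (c := c) hy
  have h2 : (c * f * c⁻¹) • c • x ≠ c • x := by
    rw [← mul_smul, inv_mul_cancel_right, mul_smul]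
    exact fun h => hx (smul_left_cancel _ h)
  rw [orbital_zpowers_eq_of_commute hD hE hfc (smul_ne_of_mem_orbital hx hcx) h2,
    orbital_eq_of_mem hcx] at h1
  exact h1

/-- The left endpoint of an orbital of `K` is fixed by `K`. -/
theorem smul_eq_self_of_isGLB_orbital {K : Subgroup G} {x p : α} (hp : IsGLB (orbital K x) p)
    {k : G} (hk : k ∈ K) : k • p = p := by
  have key : ∀ k ∈ K, p ≤ k • p := by
    intro k hk
    have : k⁻¹ • p ≤ p := by
      refine hp.2 fun y hy => ?_
      have := hp.1 (smul_mem_orbital_of_mem hk hy)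
      simpa using smul_le_smul_left k⁻¹ this
    simpa using smul_le_smul_left k this
  refine le_antisymm ?_ (key k hk)
  simpa using smul_le_smul_left k (key k⁻¹ (K.inv_mem hk))

/-- The right endpoint of an orbital of `K` is fixed by `K`. -/
theorem smul_eq_self_of_isLUB_orbital {K : Subgroup G} {x p : α} (hp : IsLUB (orbital K x) p)
    {k : G} (hk : k ∈ K) : k • p = p := by
  have key : ∀ k ∈ K, k • p ≤ p := by
    intro k hk
    have : p ≤ k⁻¹ • p := by
      refine hp.2 fun y hy => ?_
      have := hp.1 (smul_mem_orbital_of_mem hk hy)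
      simpa using smul_le_smul_left k⁻¹ this
    simpa using smul_le_smul_left k this
  refine le_antisymm (key k hk) ?_
  simpa using smul_le_smul_left k (key k⁻¹ (K.inv_mem hk))

end Orbitals

/-! ### Piecewise-linear homeomorphisms: finitely many orbitals and germs at fixed points -/

section PiecewiseLinear

/-- The tautological action of `PLo` on the unit interval. -/
instance PLo.instMulAction : MulAction PLo unitInterval where
  smul f x := f.1 x
  one_smul _ := rfl
  mul_smul _ _ _ := rfl

instance PLo.instCovariantClass : CovariantClass PLo unitInterval HSMul.hSMul LE.le :=
  ⟨fun f _ _ h => f.2.1.monotone h⟩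

theorem PLo.ext_smul {f g : PLo} (h : ∀ x : unitInterval, f • x = g • x) : f = g :=
  Subtype.ext (Homeomorph.ext h)

theorem PLo.eq_one_of_pow_eq_one {f : PLo} {n : ℕ} (hn : n ≠ 0) (h : f ^ n = 1) : f = 1 :=
  PLo.ext_smul fun x => by
    rw [one_smul]
    exact smul_eq_self_of_pow_smul_eq hn (by rw [h, one_smul])

theorem PLo.smul_one (f : PLo) : f • (1 : unitInterval) = 1 :=
  le_antisymm unitInterval.le_one' (by
    simpa using smul_le_smul_left f (unitInterval.le_one' (t := f⁻¹ • (1 : unitInterval))))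

/-- Every nontrivial orbital of a piecewise-linear homeomorphism contains a break: otherwise the
map is affine on it and fixes both endpoints. -/
theorem PLo.exists_hasOrbitalReps (f : PLo) : ∃ D : Finset unitInterval, HasOrbitalReps f D := by
  obtain ⟨B, hB, haff⟩ := f.2.2
  refine ⟨hB.toFinset, fun x hx => ?_⟩
  by_contra! hno
  set O := orbital (Subgroup.zpowers f) x with hO
  have hp : IsGLB O (sInf O) := isGLB_sInf O
  have hq : IsLUB O (sSup O) := isLUB_sSup O
  set p := sInf O
  set q := sSup O
  have hf : f ∈ Subgroup.zpowers f := Subgroup.mem_zpowers f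
  have hfp := smul_eq_self_of_isGLB_orbital hp hf
  have hfq := smul_eq_self_of_isLUB_orbital hq hf
  have hxO : x ∈ O := mem_orbital_self _ _
  have hpx : p < x := lt_of_le_of_ne (hp.1 hxO) fun h => hx (h ▸ hfp)
  have hxq : x < q := lt_of_le_of_ne (hq.1 hxO) fun h => hx (h ▸ hfq)
  have hdis : Disjoint B (Set.Ioo p q) := by
    rw [Set.disjoint_left]
    rintro b hb ⟨h1, h2⟩
    obtain ⟨y, hy, hyb⟩ := (isGLB_lt_iff hp).1 h1
    obtain ⟨z, hz, hbz⟩ := (lt_isLUB_iff hq).1 h2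
    exact hno b (hB.mem_toFinset.2 hb) (orbital_convex hy hz hyb.le hbz.le)
  obtain ⟨m, c, hm⟩ := haff p q (hpx.trans hxq) hdis
  have e1 : (p : ℝ) = m * p + c := by
    rw [← hm p ⟨le_rfl, (hpx.trans hxq).le⟩]; exact congrArg Subtype.val hfp.symm
  have e2 : (q : ℝ) = m * q + c := by
    rw [← hm q ⟨(hpx.trans hxq).le, le_rfl⟩]; exact congrArg Subtype.val hfq.symm
  have hpq : (p : ℝ) < q := hpx.trans hxq
  have hm1 : m = 1 := by
    have : (m - 1) * ((q : ℝ) - p) = 0 := by linear_combination e1 - e2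
    rcases mul_eq_zero.1 this with h | h <;> linarith
  subst hm1
  refine hx (Subtype.ext ?_)
  have := hm x ⟨hpx.le, hxq.le⟩
  change (f.1 x : ℝ) = x
  linarith

/-- `f` is affine with slope `l` on `[p, q]` and fixes the left endpoint `p`. The endpoint `q` is
auxiliary: for `p < q` the slope depends only on the germ of `f` at `p`. -/
def IsLinearFrom (f : PLo) (p q : unitInterval) (l : ℝ) : Prop :=
  ∀ z ∈ Set.Icc p q, ((f • z : unitInterval) : ℝ) = p + l * ((z : ℝ) - p)

theorem IsLinearFrom.eq {f : PLo} {p q q' : unitInterval} {l l' : ℝ} (hq : p < q) (hq' : p < q')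
    (h : IsLinearFrom f p q l) (h' : IsLinearFrom f p q' l') : l = l' := by
  have hpm : p < min q q' := lt_min hq hq'
  have h1 := h (min q q') ⟨hpm.le, min_le_left _ _⟩
  have h2 := h' (min q q') ⟨hpm.le, min_le_right _ _⟩
  have h3 : (p : ℝ) < (min q q' : unitInterval) := hpm
  have : (l - l') * (((min q q' : unitInterval) : ℝ) - p) = 0 := by linear_combination h2 - h1
  rcases mul_eq_zero.1 this with h | h <;> linarith

theorem PLo.exists_isLinearFrom {f : PLo} {p : unitInterval} (hfp : f • p = p) (hp : p < 1) :
    ∃ q, p < q ∧ ∃ l : ℝ, 0 < l ∧ IsLinearFrom f p q l := by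
  obtain ⟨B, hB, haff⟩ := f.2.2
  have hfin : (insert 1 (B ∩ Set.Ioi p)).Finite := (hB.inter_of_left _).insert 1
  obtain ⟨q, hq, hmin⟩ := Set.exists_min_image _ id hfin (Set.insert_nonempty _ _)
  have hpq : p < q := by
    rcases hq with rfl | hq
    · exact hp
    · exact hq.2
  obtain ⟨m, c, hm⟩ := haff p q hpq (by
    rw [Set.disjoint_left]
    intro b hb hbI
    exact absurd hbI.2 (not_lt.2 (hmin b (Or.inr ⟨hb, hbI.1⟩))))
  have e1 : (p : ℝ) = m * p + c := by
    rw [← hm p ⟨le_rfl, hpq.le⟩]; exact congrArg Subtype.val hfp.symm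
  have hlin : IsLinearFrom f p q m := by
    intro z hz
    have := hm z hz
    change (f.1 z : ℝ) = _
    linear_combination this - e1
  refine ⟨q, hpq, m, ?_, hlin⟩
  have h1 := hlin q ⟨hpq.le, le_rfl⟩
  have h2 : (p : ℝ) < (f • q : unitInterval) := by
    have := (smul_lt_smul_iff_of_group (g := f)).2 hpq
    rwa [hfp] at this
  have h3 : (p : ℝ) < q := hpq
  by_contra hneg
  nlinarith

theorem IsLinearFrom.smul_eq {f : PLo} {p q : unitInterval} {l : ℝ} (hpq : p ≤ q)
    (h : IsLinearFrom f p q l) : f • p = p := by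
  refine Subtype.ext ?_
  rw [h p ⟨le_rfl, hpq⟩]
  ring

/-- Slopes of germs multiply under composition. -/
theorem IsLinearFrom.mul {f g : PLo} {p q q' : unitInterval} {l l' : ℝ} (hq : p < q) (hq' : p < q')
    (hf : IsLinearFrom f p q l) (hg : IsLinearFrom g p q' l') :
    ∃ r, p < r ∧ IsLinearFrom (f * g) p r (l * l') := by
  have hgp := hg.smul_eq hq'.le
  have hr : p < min q' (g⁻¹ • q) := by
    refine lt_min hq' ?_
    have := (smul_lt_smul_iff_of_group (g := g⁻¹)).2 hq
    rwa [inv_smul_eq_iff.2 hgp.symm] at this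
  refine ⟨_, hr, fun z hz => ?_⟩
  have h1 := hg z ⟨hz.1, hz.2.trans (min_le_left _ _)⟩
  have h2 : g • z ∈ Set.Icc p q := by
    constructor
    · have := smul_le_smul_left g hz.1
      rwa [hgp] at this
    · simpa using smul_le_smul_left g (hz.2.trans (min_le_right _ _))
  rw [mul_smul, hf _ h2, h1]
  ring

/-- Germs at a common fixed point are linear, so they commute. -/
theorem PLo.exists_smul_comm {f g : PLo} {p : unitInterval} (hf : f • p = p) (hg : g • p = p)
    (hp : p < 1) : ∃ q, p < q ∧ ∀ z ∈ Set.Icc p q, f • g • z = g • f • z := by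
  obtain ⟨q, hq, l, -, hfl⟩ := PLo.exists_isLinearFrom hf hp
  obtain ⟨q', hq', l', -, hgl⟩ := PLo.exists_isLinearFrom hg hp
  obtain ⟨r, hr, h1⟩ := hfl.mul hq hq' hgl
  obtain ⟨r', hr', h2⟩ := hgl.mul hq' hq hfl
  refine ⟨min r r', lt_min hr hr', fun z hz => Subtype.ext ?_⟩
  have h1 := h1 z ⟨hz.1, hz.2.trans (min_le_left _ _)⟩
  have h2 := h2 z ⟨hz.1, hz.2.trans (min_le_right _ _)⟩
  rw [mul_smul] at h1 h2
  rw [h1, h2, mul_comm l l']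

theorem PLo.smul_mem_orbital_of_commute_conj {f c : PLo} (hfc : Commute f (c * f * c⁻¹))
    {x y : unitInterval} (hx : f • x ≠ x) (hcx : c • x ∈ orbital (Subgroup.zpowers f) x)
    (hy : y ∈ orbital (Subgroup.zpowers f) x) :
    c • y ∈ orbital (Subgroup.zpowers f) x := by
  obtain ⟨D, hD⟩ := PLo.exists_hasOrbitalReps f
  obtain ⟨E, hE⟩ := PLo.exists_hasOrbitalReps (c * f * c⁻¹)
  exact _root_.smul_mem_orbital_of_commute_conj hD hE hfc hx hcx hy

theorem PLo.orbital_eq_of_commute {f g : PLo} (hfg : Commute f g) {x : unitInterval}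
    (hx : f • x ≠ x) (hx' : g • x ≠ x) :
    orbital (Subgroup.zpowers g) x = orbital (Subgroup.zpowers f) x := by
  obtain ⟨D, hD⟩ := PLo.exists_hasOrbitalReps f
  obtain ⟨E, hE⟩ := PLo.exists_hasOrbitalReps g
  exact orbital_zpowers_eq_of_commute hD hE hfg hx hx'

theorem PLo.smul_eq_self_of_commute {f g : PLo} (hfg : Commute f g) {x y : unitInterval}
    (hx : f • x ≠ x) (hy : y ∈ orbital (Subgroup.zpowers f) x) (hgy : g • y = y) :
    g • x = x := by
  obtain ⟨D, hD⟩ := PLo.exists_hasOrbitalReps f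
  obtain ⟨E, hE⟩ := PLo.exists_hasOrbitalReps g
  exact smul_eq_self_of_commute_of_fixed hD hE hfg hx hy hgy

/-- If a conjugate `c * f * c⁻¹` commutes with `f` and `c` preserves an orbital of `f`, then the
conjugate agrees with `f` there: both have the same germ at the left endpoint, so their quotient
commutes with `f` and has a fixed point in the orbital. -/
theorem PLo.conj_smul_eq {f c : PLo} (hfc : Commute f (c * f * c⁻¹)) {x : unitInterval}
    (hx : f • x ≠ x) (hcx : c • x ∈ orbital (Subgroup.zpowers f) x) :
    (c * f * c⁻¹) • x = f • x := by
  set O := orbital (Subgroup.zpowers f) x with hO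
  have hp : IsGLB O (sInf O) := isGLB_sInf O
  set p := sInf O
  have hpf := smul_eq_self_of_isGLB_orbital hp (Subgroup.mem_zpowers f)
  have hpx : p < x := lt_of_le_of_ne (hp.1 (mem_orbital_self _ _)) fun h => hx (h ▸ hpf)
  have hpO : ∀ y ∈ O, c • y ∈ O := fun y hy =>
    PLo.smul_mem_orbital_of_commute_conj hfc hx hcx hy
  -- `c⁻¹` preserves the orbital too: this is the previous fact for the conjugate
  -- element at the point `c • x`
  have hpO' : ∀ y ∈ O, c⁻¹ • y ∈ O := by
    intro y hy
    have hmove : (c * f * c⁻¹) • c • x ≠ c • x := by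
      rw [← mul_smul, inv_mul_cancel_right, mul_smul]
      exact fun h => hx (smul_left_cancel _ h)
    have h1 : orbital (Subgroup.zpowers (c * f * c⁻¹)) (c • x) = O := by
      rw [PLo.orbital_eq_of_commute hfc (smul_ne_of_mem_orbital hx hcx) hmove,
        orbital_eq_of_mem hcx]
    rw [← h1] at hy
    have h2 := mem_orbital_zpowers_conj (c := c⁻¹) hy
    rwa [inv_smul_smul, inv_inv, mul_assoc, inv_mul_cancel_right, inv_mul_cancel_left] at h2
  have hcp : c • p = p := by
    refine le_antisymm ?_ ?_
    · refine hp.2 fun y hy => ?_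
      simpa using smul_le_smul_left c (hp.1 (hpO' y hy))
    · have : c⁻¹ • p ≤ p := by
        refine hp.2 fun y hy => ?_
        simpa using smul_le_smul_left c⁻¹ (hp.1 (hpO y hy))
      simpa using smul_le_smul_left c this
  obtain ⟨q, hpq, hq⟩ := PLo.exists_smul_comm hcp hpf (hpx.trans_le unitInterval.le_one')
  obtain ⟨z, hz, hzq⟩ := (isGLB_lt_iff hp).1 hpq
  have hzc : c • f • z = f • c • z := hq z ⟨hp.1 hz, hzq.le⟩
  have hfix : (f⁻¹ * (c * f * c⁻¹)) • c • z = c • z := by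
    simp only [mul_smul, inv_smul_smul, hzc]
  have := PLo.smul_eq_self_of_commute (((Commute.refl f).inv_right).mul_right hfc) hx
    (hpO z hz) hfix
  rw [mul_smul, inv_smul_eq_iff] at this
  exact this

/-- In a nonabelian group `T`, commutators are trivial near the left endpoint of an orbital of
`T`, so some conjugate of a nontrivial commutator is trivial on the orbital up to any given
point. -/
theorem PLo.exists_ne_one_fixing_initial {T : Subgroup PLo} {s t : PLo} (hs : s ∈ T) (ht : t ∈ T)
    (hst : s * t ≠ t * s) (y : unitInterval) :
    ∃ c ∈ T, c ≠ 1 ∧ ∀ w ∈ orbital T y, w ≤ y → c • w = w := by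
  set O := orbital T y with hO
  have hp : IsGLB O (sInf O) := isGLB_sInf O
  set p := sInf O
  have hpT : ∀ k ∈ T, k • p = p := fun k hk => smul_eq_self_of_isGLB_orbital hp hk
  set c₀ : PLo := (t * s)⁻¹ * (s * t) with hc₀
  have hc₀T : c₀ ∈ T := T.mul_mem (T.inv_mem (T.mul_mem ht hs)) (T.mul_mem hs ht)
  have hc₀1 : c₀ ≠ 1 := fun h => hst (inv_mul_eq_one.1 h).symm
  rcases eq_or_lt_of_le (unitInterval.le_one' (t := p)) with h1 | h1
  · refine ⟨c₀, hc₀T, hc₀1, fun w hw _ => ?_⟩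
    have : w = 1 := le_antisymm unitInterval.le_one' (h1 ▸ hp.1 hw)
    rw [this, PLo.smul_one]
  obtain ⟨q, hpq, hq⟩ := PLo.exists_smul_comm (hpT s hs) (hpT t ht) h1
  obtain ⟨z, hz, hzq⟩ := (isGLB_lt_iff hp).1 hpq
  obtain ⟨-, -, h, hh, -, hy⟩ := mem_orbital_symm hz
  refine ⟨h * c₀ * h⁻¹, T.mul_mem (T.mul_mem hh hc₀T) (T.inv_mem hh), ?_, fun w hw hwy => ?_⟩
  · rwa [Ne, conj_eq_one_iff]
  have hw1 : h⁻¹ • w ≤ q := by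
    refine le_trans ?_ hzq.le
    simpa using smul_le_smul_left h⁻¹ (hwy.trans hy)
  have hw2 : p ≤ h⁻¹ • w := hp.1 (smul_mem_orbital_of_mem (T.inv_mem hh) hw)
  have := hq _ ⟨hw2, hw1⟩
  rw [hc₀, mul_smul, mul_smul, mul_smul, mul_smul, this, ← mul_smul t s, inv_smul_smul,
    smul_inv_smul]

end PiecewiseLinear

/-! ### Translates of an orbital with large stabilizers -/

section Core

variable {T A : Subgroup PLo} {a : PLo}

/-- Every finite set of `T`-translates of the orbital of `a` at `y` is preserved by a common
nontrivial element of `T`. -/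
def HasLargeStabilizers (T : Subgroup PLo) (a : PLo) (y : unitInterval) : Prop :=
  ∀ F : Finset PLo, (∀ g ∈ F, g ∈ T) → ∃ c ∈ T, c ≠ 1 ∧
    ∀ g ∈ F, (g⁻¹ * c * g) • y ∈ orbital (Subgroup.zpowers a) y

/-- The union of the `T`-translates of the orbital of `a` at `y`, a `T`-invariant set. -/
def orbitalSweep (T : Subgroup PLo) (a : PLo) (y : unitInterval) : Set unitInterval :=
  {z | ∃ g ∈ T, g • z ∈ orbital (Subgroup.zpowers a) y}

theorem smul_mem_orbitalSweep_iff {y z : unitInterval} {c : PLo} (hc : c ∈ T) :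
    c • z ∈ orbitalSweep T a y ↔ z ∈ orbitalSweep T a y := by
  constructor
  · rintro ⟨g, hg, h⟩
    exact ⟨g * c, T.mul_mem hg hc, by rwa [mul_smul]⟩
  · rintro ⟨g, hg, h⟩
    exact ⟨g * c⁻¹, T.mul_mem hg (T.inv_mem hc), by rwa [mul_smul, inv_smul_smul]⟩

/-- The orbitals of `b ∈ A` inside a sweep are translates of the orbital of `a`. -/
theorem mem_orbital_iff_of_mem_orbitalSweep (hA : ∀ b ∈ A, ∀ b' ∈ A, Commute b b')
    (hT : ∀ t ∈ T, ∀ b ∈ A, t * b * t⁻¹ ∈ A) (ha : a ∈ A) {b : PLo} (hb : b ∈ A)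
    {y w : unitInterval} (hy : a • y ≠ y) {g : PLo} (hg : g ∈ T)
    (hgw : g • w ∈ orbital (Subgroup.zpowers a) y) (hw : b • w ≠ w) (v : unitInterval) :
    v ∈ orbital (Subgroup.zpowers b) w ↔ g • v ∈ orbital (Subgroup.zpowers a) y := by
  have hag : g⁻¹ * a * g ∈ A := by simpa using hT g⁻¹ (T.inv_mem hg) a ha
  have hmove : (g⁻¹ * a * g) • w ≠ w := by
    intro h
    rw [mul_smul, mul_smul, inv_smul_eq_iff] at h
    exact smul_ne_of_mem_orbital hy hgw h
  rw [PLo.orbital_eq_of_commute (hA _ hag _ hb) hmove hw, ← orbital_eq_of_mem hgw]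
  constructor
  · intro h
    have := mem_orbital_zpowers_conj (c := g) h
    rwa [← mul_assoc, ← mul_assoc, mul_inv_cancel, one_mul, mul_inv_cancel_right] at this
  · intro h
    have := mem_orbital_zpowers_conj (c := g⁻¹) h
    rwa [inv_smul_smul, inv_smul_smul, inv_inv] at this

/-- The orbitals of `b ∈ A` inside the sweep are finitely many translates of the orbital of `a`, so
some nontrivial `c ∈ T` preserves all of them; conjugation by such a `c` does not change `b` on the
sweep. -/
theorem exists_conj_eq_on_orbitalSweep (hA : ∀ b ∈ A, ∀ b' ∈ A, Commute b b')
    (hT : ∀ t ∈ T, ∀ b ∈ A, t * b * t⁻¹ ∈ A) (ha : a ∈ A) {b : PLo} (hb : b ∈ A)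
    {y : unitInterval} (hy : a • y ≠ y) (hlarge : HasLargeStabilizers T a y) :
    ∃ c ∈ T, c ≠ 1 ∧ ∀ z ∈ orbitalSweep T a y, (c * b * c⁻¹) • z = b • z := by
  classical
  obtain ⟨D, hD⟩ := PLo.exists_hasOrbitalReps b
  have hch : ∀ d, ∃ g ∈ T, d ∈ orbitalSweep T a y → g • d ∈ orbital (Subgroup.zpowers a) y := by
    intro d
    by_cases hd : d ∈ orbitalSweep T a y
    · obtain ⟨g, hg, h⟩ := hd
      exact ⟨g, hg, fun _ => h⟩
    · exact ⟨1, T.one_mem, fun h => absurd h hd⟩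
  choose γ hγT hγ using hch
  obtain ⟨c, hcT, hc1, hc⟩ := hlarge (D.image fun d => (γ d)⁻¹) (by
    intro g hg
    obtain ⟨d, -, rfl⟩ := Finset.mem_image.1 hg
    exact T.inv_mem (hγT d))
  have hbc : Commute b (c * b * c⁻¹) := hA _ hb _ (hT c hcT b hb)
  have key : ∀ w ∈ orbitalSweep T a y, b • w ≠ w → c • w ∈ orbital (Subgroup.zpowers b) w := by
    intro w hwU hw
    obtain ⟨d, hdD, hd⟩ := hD w hw
    obtain ⟨g, hg, hgw⟩ := hwU
    have hdU : d ∈ orbitalSweep T a y :=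
      ⟨g, hg, (mem_orbital_iff_of_mem_orbitalSweep hA hT ha hb hy hg hgw hw d).1 hd⟩
    have hdm : b • d ≠ d := smul_ne_of_mem_orbital hw hd
    have hiff := mem_orbital_iff_of_mem_orbitalSweep hA hT ha hb hy (hγT d) (hγ d hdU) hdm
    -- `v` lies in the orbital of `b` through `w`, and so does `c • v`
    set v := (γ d)⁻¹ • y with hv
    have h1 : v ∈ orbital (Subgroup.zpowers b) d :=
      (hiff v).2 (by rw [hv, smul_inv_smul]; exact mem_orbital_self _ _)
    have h2 : c • v ∈ orbital (Subgroup.zpowers b) d := by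
      refine (hiff _).2 ?_
      have := hc _ (Finset.mem_image_of_mem _ hdD)
      rwa [inv_inv, mul_smul, mul_smul] at this
    rw [← orbital_eq_of_mem h1] at h2
    have hvm : b • v ≠ v := smul_ne_of_mem_orbital hdm h1
    have hvw : v ∈ orbital (Subgroup.zpowers b) w := mem_orbital_trans hd h1
    have := PLo.smul_mem_orbital_of_commute_conj hbc hvm h2 (mem_orbital_symm hvw)
    rwa [orbital_eq_of_mem hvw] at this
  refine ⟨c, hcT, hc1, fun z hz => ?_⟩
  by_cases hzb : b • z = z
  · have : b • c⁻¹ • z = c⁻¹ • z := by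
      by_contra hne
      have := key _ ((smul_mem_orbitalSweep_iff (T.inv_mem hcT)).2 hz) hne
      rw [smul_inv_smul] at this
      exact smul_ne_of_mem_orbital hne this hzb
    rw [mul_smul, mul_smul, this, smul_inv_smul, hzb]
  · exact PLo.conj_smul_eq hbc hzb (key z hz hzb)

/-- A nontrivial `b ∈ A` cannot be supported in finitely many sweeps with large stabilizers: taking
commutators with elements of `T` removes the sweeps one at a time without producing `1`. -/
theorem eq_one_of_supported (hA : ∀ b ∈ A, ∀ b' ∈ A, Commute b b')
    (hT : ∀ t ∈ T, ∀ b ∈ A, t * b * t⁻¹ ∈ A)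
    (hfree : ∀ t ∈ T, ∀ b ∈ A, t * b * t⁻¹ = b → t = 1 ∨ b = 1) (ha : a ∈ A)
    (Y : Finset unitInterval) (hY : ∀ y ∈ Y, a • y ≠ y ∧ HasLargeStabilizers T a y)
    {b : PLo} (hb : b ∈ A) (hsupp : ∀ z, b • z ≠ z → ∃ y ∈ Y, z ∈ orbitalSweep T a y) :
    b = 1 := by
  classical
  induction Y using Finset.induction_on generalizing b with
  | empty =>
    refine PLo.ext_smul fun z => ?_
    by_contra hne
    rw [one_smul] at hne
    obtain ⟨y, hy, -⟩ := hsupp z hne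
    exact absurd hy (Finset.notMem_empty y)
  | insert y Y _ ih =>
    obtain ⟨hy, hlarge⟩ := hY y (Finset.mem_insert_self _ _)
    obtain ⟨c, hcT, hc1, hc⟩ := exists_conj_eq_on_orbitalSweep hA hT ha hb hy hlarge
    have hb' : b⁻¹ * (c * b * c⁻¹) = 1 := by
      refine ih (fun y' hy' => hY y' (Finset.mem_insert_of_mem hy'))
        (A.mul_mem (A.inv_mem hb) (hT c hcT b hb)) fun z hz => ?_
      have hzy : z ∉ orbitalSweep T a y := by
        intro h
        rw [mul_smul, hc z h, inv_smul_smul] at hz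
        exact hz rfl
      have : ∃ y' ∈ insert y Y, z ∈ orbitalSweep T a y' := by
        by_cases hbz : b • z = z
        · have hbc : b • c⁻¹ • z ≠ c⁻¹ • z := by
            intro h
            rw [mul_smul, mul_smul, mul_smul, h, smul_inv_smul, inv_smul_eq_iff.2 hbz.symm] at hz
            exact hz rfl
          obtain ⟨y', hy', h⟩ := hsupp _ hbc
          exact ⟨y', hy', (smul_mem_orbitalSweep_iff (T.inv_mem hcT)).1 h⟩
        · exact hsupp z hbz
      obtain ⟨y', hy', h⟩ := this
      rcases Finset.mem_insert.1 hy' with rfl | hy'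
      · exact absurd h hzy
      · exact ⟨y', hy', h⟩
    rcases hfree c hcT b hb (inv_mul_eq_one.1 hb').symm with h | h
    · exact absurd h hc1
    · exact h

/-- The nontrivial orbitals of `a` are finitely many and carry its support, so not all of them can
have large stabilizers. -/
theorem exists_not_hasLargeStabilizers (hA : ∀ b ∈ A, ∀ b' ∈ A, Commute b b')
    (hT : ∀ t ∈ T, ∀ b ∈ A, t * b * t⁻¹ ∈ A)
    (hfree : ∀ t ∈ T, ∀ b ∈ A, t * b * t⁻¹ = b → t = 1 ∨ b = 1) (ha : a ∈ A) (ha1 : a ≠ 1) :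
    ∃ y : unitInterval, a • y ≠ y ∧ ¬ HasLargeStabilizers T a y := by
  classical
  by_contra! hall
  obtain ⟨D, hD⟩ := PLo.exists_hasOrbitalReps a
  refine ha1 (eq_one_of_supported hA hT hfree ha (D.filter fun d => a • d ≠ d)
    (fun y hy => ⟨(Finset.mem_filter.1 hy).2, hall y (Finset.mem_filter.1 hy).2⟩) ha
    fun z hz => ?_)
  obtain ⟨d, hd, h⟩ := hD z hz
  refine ⟨d, Finset.mem_filter.2 ⟨hd, smul_ne_of_mem_orbital hz h⟩, 1, T.one_mem, ?_⟩
  rw [one_smul]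
  exact mem_orbital_symm h

/-- If large stabilizers fail at some orbital of `a`, then `T` is abelian: otherwise a conjugate of a
commutator would fix any given finite set of points of the `T`-orbit of `y`. -/
theorem mul_comm_of_not_hasLargeStabilizers {y : unitInterval}
    (hnot : ¬ HasLargeStabilizers T a y) : ∀ s ∈ T, ∀ t ∈ T, s * t = t * s := by
  intro s hs t ht
  by_contra hst
  refine hnot fun F hF => ?_
  classical
  obtain ⟨m, hmO, hm⟩ : ∃ m ∈ orbital T y, ∀ g ∈ F, g • y ≤ m := by
    have hne : (insert y (F.image fun g => g • y)).Nonempty := Finset.insert_nonempty _ _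
    refine ⟨Finset.max' _ hne, ?_, fun g hg => Finset.le_max' _ _
      (Finset.mem_insert_of_mem (Finset.mem_image_of_mem (fun g => g • y) hg))⟩
    rcases Finset.mem_insert.1 (Finset.max'_mem _ hne) with h | h
    · rw [h]; exact mem_orbital_self _ _
    · obtain ⟨g, hg, h⟩ := Finset.mem_image.1 h
      rw [← h]; exact smul_mem_orbital (hF g hg) y
  obtain ⟨c, hcT, hc1, hc⟩ := PLo.exists_ne_one_fixing_initial hs ht hst m
  refine ⟨c, hcT, hc1, fun g hg => ?_⟩
  have : c • g • y = g • y := hc _ (by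
    rw [orbital_eq_of_mem hmO]; exact smul_mem_orbital (hF g hg) y) (hm g hg)
  rw [mul_smul, mul_smul, this, inv_smul_smul]
  exact mem_orbital_self _ _

/-- `T` is abelian, and some orbital of `a` is preserved only by the identity of `T`. -/
theorem exists_wandering_orbital (hA : ∀ b ∈ A, ∀ b' ∈ A, Commute b b')
    (hT : ∀ t ∈ T, ∀ b ∈ A, t * b * t⁻¹ ∈ A)
    (hfree : ∀ t ∈ T, ∀ b ∈ A, t * b * t⁻¹ = b → t = 1 ∨ b = 1) (ha : a ∈ A) (ha1 : a ≠ 1) :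
    (∀ s ∈ T, ∀ t ∈ T, s * t = t * s) ∧ ∃ y : unitInterval, a • y ≠ y ∧
      ∀ t ∈ T, t ≠ 1 → t • y ∉ orbital (Subgroup.zpowers a) y := by
  obtain ⟨y, hy, hnot⟩ := exists_not_hasLargeStabilizers hA hT hfree ha ha1
  have hcomm := mul_comm_of_not_hasLargeStabilizers hnot
  refine ⟨hcomm, y, hy, fun t ht ht1 hty => hnot fun F hF => ⟨t, ht, ht1, fun g hg => ?_⟩⟩
  rwa [mul_assoc, hcomm t ht g (hF g hg), inv_mul_cancel_left]

/-! ### Slopes of an abelian group with a wandering orbital -/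

/-- Near the left endpoint of its orbital, `T` acts by linear maps, and the ratio of the endpoints
of the translates of a wandering interval bounds the slopes other than `1` away from `1`. -/
theorem nonempty_mulEquiv_int_of_wandering (hcomm : ∀ s ∈ T, ∀ t ∈ T, s * t = t * s)
    {y : unitInterval} (hy : a • y ≠ y)
    (hwand : ∀ t ∈ T, t ≠ 1 → t • y ∉ orbital (Subgroup.zpowers a) y) (hTne : ∃ t ∈ T, t ≠ 1) :
    Nonempty (T ≃* Multiplicative ℤ) := by
  set J := orbital T y with hJ
  have hp : IsGLB J (sInf J) := isGLB_sInf J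
  set p := sInf J
  have hpT : ∀ k ∈ T, k • p = p := fun k hk => smul_eq_self_of_isGLB_orbital hp hk
  have hmove : ∀ t ∈ T, t ≠ 1 → t • y ≠ y := fun t ht ht1 h =>
    hwand t ht ht1 (h.symm ▸ mem_orbital_self _ y)
  obtain ⟨t₁, ht₁, ht₁1⟩ := hTne
  have hpJ : p ∉ J := by
    intro h
    have := eq_of_mem_orbital_of_fixed hpT (mem_orbital_symm h)
    exact hmove t₁ ht₁ ht₁1 (this ▸ hpT t₁ ht₁)
  have hlt : ∀ z ∈ J, p < z := fun z hz => lt_of_le_of_ne (hp.1 hz) fun h => hpJ (h ▸ hz)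
  have hyJ : y ∈ J := mem_orbital_self _ _
  have hp1 : p < 1 := (hlt y hyJ).trans_le unitInterval.le_one'
  -- a nontrivial element of `T` has no fixed point in `J`
  have hnofix : ∀ t ∈ T, ∀ z ∈ J, t • z = z → t = 1 := by
    intro t ht z hz htz
    by_contra ht1
    obtain ⟨D, hD⟩ := PLo.exists_hasOrbitalReps t
    obtain ⟨g, hg, h, hh, h1, h2⟩ := hz
    exact smul_ne_of_mem_orbital (hmove t ht ht1) (orbital_convex
      (smul_mem_orbital_of_commute hD (hcomm t ht g hg) (hmove t ht ht1))
      (smul_mem_orbital_of_commute hD (hcomm t ht h hh) (hmove t ht ht1)) h1 h2) htz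
  choose! ε hε l hl0 hl using fun t (ht : t ∈ T) => PLo.exists_isLinearFrom (hpT t ht) hp1
  have hl1 : ∀ t ∈ T, l t = 1 → t = 1 := by
    intro t ht h
    obtain ⟨z, hz, hzε⟩ := (isGLB_lt_iff hp).1 (hε t ht)
    refine hnofix t ht z hz (Subtype.ext ?_)
    rw [hl t ht z ⟨(hlt z hz).le, hzε.le⟩, h]
    ring
  have hlmul : ∀ s ∈ T, ∀ t ∈ T, l (s * t) = l s * l t := by
    intro s hs t ht
    obtain ⟨r, hr, h⟩ := (hl s hs).mul (hε s hs) (hε t ht) (hl t ht)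
    exact (hl _ (T.mul_mem hs ht)).eq (hε _ (T.mul_mem hs ht)) hr h
  let φ : T →* Multiplicative ℝ := MonoidHom.mk' (fun t => Multiplicative.ofAdd (Real.log (l t)))
    (fun s t => by
      rw [← ofAdd_add, ← Real.log_mul (hl0 s s.2).ne' (hl0 t t.2).ne', ← hlmul s s.2 t t.2]
      rfl)
  have hφ : Function.Injective φ := by
    refine (injective_iff_map_eq_one φ).2 fun t ht => Subtype.ext (hl1 t t.2 ?_)
    have : Real.log (l t) = 0 := congrArg Multiplicative.toAdd ht
    exact Real.eq_one_of_pos_of_log_eq_zero (hl0 t t.2) this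
  -- an element of `T` contracting towards `p`
  obtain ⟨t₀, ht₀, hlt₀⟩ : ∃ t ∈ T, l t < 1 := by
    rcases lt_trichotomy (l t₁) 1 with h | h | h
    · exact ⟨t₁, ht₁, h⟩
    · exact absurd (hl1 t₁ ht₁ h) ht₁1
    · refine ⟨t₁⁻¹, T.inv_mem ht₁, ?_⟩
      have h1 := hlmul t₁ ht₁ t₁⁻¹ (T.inv_mem ht₁)
      have h2 : l 1 = 1 := by
        have := hlmul 1 T.one_mem 1 T.one_mem
        rw [one_mul] at this
        exact (mul_eq_left₀ (hl0 1 T.one_mem).ne').1 this.symm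
      rw [mul_inv_cancel, h2] at h1
      nlinarith [hl0 t₁⁻¹ (T.inv_mem ht₁)]
  -- a second point `v > y` of the orbital of `a`, which still lies in `J`
  obtain ⟨v, hyv, hv⟩ : ∃ v, y < v ∧ v ∈ orbital (Subgroup.zpowers a) y := by
    rcases lt_or_gt_of_ne hy with h | h
    · refine ⟨a⁻¹ • y, ?_, smul_mem_orbital (Subgroup.inv_mem _ (Subgroup.mem_zpowers a)) y⟩
      simpa using (smul_lt_smul_iff_of_group (g := a⁻¹)).2 h
    · exact ⟨a • y, h, smul_mem_orbital (Subgroup.mem_zpowers a) y⟩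
  have hvJ : v ∈ J := by
    obtain ⟨t, ht, hty, ht1⟩ : ∃ t ∈ T, y < t • y ∧ t ≠ 1 := by
      rcases lt_or_gt_of_ne (hmove t₁ ht₁ ht₁1) with h | h
      · refine ⟨t₁⁻¹, T.inv_mem ht₁, ?_, inv_ne_one.2 ht₁1⟩
        simpa using (smul_lt_smul_iff_of_group (g := t₁⁻¹)).2 h
      · exact ⟨t₁, ht₁, h, ht₁1⟩
    refine orbital_convex hyJ (smul_mem_orbital ht y) hyv.le ?_
    by_contra! hcon
    exact hwand t ht ht1 (orbital_convex (mem_orbital_self _ _) hv hty.le hcon.le)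
  -- a translate of `[y, v]` in the linear domain of `t₀`
  obtain ⟨z, hz, hzε⟩ := (isGLB_lt_iff hp).1 (hε t₀ ht₀)
  obtain ⟨g₀, hg₀, -, -, hgv, -⟩ := mem_orbital_trans (mem_orbital_symm hvJ) hz
  have hu0 : p < g₀ • y := hlt _ (smul_mem_orbital hg₀ y)
  have huv0 : g₀ • y < g₀ • v := smul_lt_smul_iff_of_group.2 hyv
  have hiter : ∀ k : ℕ, ∀ w : unitInterval, p ≤ w → w ≤ g₀ • v →
      ((t₀ ^ k • w : unitInterval) : ℝ) = p + l t₀ ^ k * ((w : ℝ) - p) ∧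
        t₀ ^ k • w ∈ Set.Icc p (ε t₀) := by
    intro k w hw1 hw2
    induction k with
    | zero => exact ⟨by simp, by simpa using ⟨hw1, hw2.trans (hgv.trans hzε.le)⟩⟩
    | succ k ih =>
      have h1 := hl t₀ ht₀ _ ih.2
      have h2 : ((t₀ • t₀ ^ k • w : unitInterval) : ℝ) ≤ (t₀ ^ k • w : unitInterval) := by
        have : (p : ℝ) ≤ (t₀ ^ k • w : unitInterval) := ih.2.1
        rw [h1]; nlinarith
      rw [pow_succ' t₀, mul_smul]
      refine ⟨by rw [h1, ih.1]; ring, ?_, le_trans h2 ih.2.2⟩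
      have := smul_le_smul_left t₀ ih.2.1
      rwa [hpT t₀ ht₀] at this
  set α : ℝ := ((g₀ • y : unitInterval) : ℝ) - p with hα
  set β : ℝ := ((g₀ • v : unitInterval) : ℝ) - p with hβ
  have hα0 : 0 < α := sub_pos.2 hu0
  have hαβ : α < β := sub_lt_sub_right (show ((g₀ • y : unitInterval) : ℝ) < _ from huv0) _
  have hβ0 : 0 < β := hα0.trans hαβ
  -- a slope strictly between `1` and `β / α` would make a translate of `[y, v]` overlap itself
  have hgap : ∀ t ∈ T, 1 < l t → β / α ≤ l t := by
    intro t ht h1t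
    by_contra! hlt'
    rw [lt_div_iff₀ hα0] at hlt'
    have hεt : 0 < ((ε t : ℝ) - p) / β := div_pos (sub_pos.2 (hε t ht)) hβ0
    obtain ⟨k, hk⟩ := exists_pow_lt_of_lt_one hεt hlt₀
    rw [lt_div_iff₀ hβ0] at hk
    have hk0 : 0 < l t₀ ^ k := pow_pos (hl0 t₀ ht₀) k
    obtain ⟨hu, hu'⟩ := hiter k (g₀ • y) hu0.le huv0.le
    obtain ⟨hv', -⟩ := hiter k (g₀ • v) (hu0.trans huv0).le le_rfl
    rw [← hα] at hu
    rw [← hβ] at hv'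
    have hg : t₀ ^ k * g₀ ∈ T := T.mul_mem (T.pow_mem ht₀ k) hg₀
    rw [← mul_smul] at hu hv' hu'
    set g := t₀ ^ k * g₀
    have hmul : l t₀ ^ k * α < l t₀ ^ k * β := mul_lt_mul_of_pos_left hαβ hk0
    have hmul' : l t₀ ^ k * (l t * α) < l t₀ ^ k * β := mul_lt_mul_of_pos_left hlt' hk0
    have hgε : g • y ≤ ε t := by
      change ((g • y : unitInterval) : ℝ) ≤ ε t
      linarith
    have ht' := hl t ht _ ⟨hu'.1, hgε⟩
    rw [hu] at ht'
    have h1 : g • y ≤ g • t • y := by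
      rw [← mul_smul g t y, hcomm g hg t ht, mul_smul]
      change ((g • y : unitInterval) : ℝ) ≤ ((t • g • y : unitInterval) : ℝ)
      rw [hu, ht']
      nlinarith [mul_pos hk0 hα0]
    have h2 : g • t • y ≤ g • v := by
      rw [← mul_smul g t y, hcomm g hg t ht, mul_smul]
      change ((t • g • y : unitInterval) : ℝ) ≤ ((g • v : unitInterval) : ℝ)
      rw [hv', ht']
      nlinarith
    have ht1 : t ≠ 1 := by
      rintro rfl
      refine h1t.ne' ?_
      have := hlmul 1 T.one_mem 1 T.one_mem
      rw [one_mul] at this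
      exact (mul_eq_left₀ (hl0 1 T.one_mem).ne').1 this.symm
    exact hwand t ht ht1 (orbital_convex (mem_orbital_self _ _) hv
      (smul_le_smul_iff_of_group.1 h1) (smul_le_smul_iff_of_group.1 h2))
  obtain ⟨r, hr⟩ := Subgroup.cyclic_of_isolated_one (H := φ.range)
    (a := Multiplicative.ofAdd (Real.log (β / α)))
    (Real.log_pos ((one_lt_div hα0).2 hαβ)) (by
      rw [Set.disjoint_left]
      rintro _ ⟨t, rfl⟩ ⟨h1, h2⟩
      have h1 : 0 < Real.log (l t) := h1
      have h2 : Real.log (l t) < Real.log (β / α) := h2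
      refine absurd (hgap t t.2 ((Real.log_pos_iff (hl0 t t.2).le).1 h1)) (not_le.2 ?_)
      exact (Real.log_lt_log_iff (hl0 t t.2) (div_pos hβ0 hα0)).1 h2)
  have hcyc : IsCyclic φ.range :=
    Subgroup.isCyclic_iff_exists_zpowers_eq_top _ |>.2 ⟨r, by rw [hr, Subgroup.zpowers_eq_closure]⟩
  have : IsCyclic T := isCyclic_of_injective φ.rangeRestrict (fun s t h => hφ (congrArg Subtype.val h))
  have : Infinite T := by
    refine Infinite.of_injective (fun n : ℕ => (⟨t₁ ^ n, T.pow_mem ht₁ n⟩ : T)) ?_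
    intro m n hmn
    have h : t₁ ^ m = t₁ ^ n := congrArg Subtype.val hmn
    by_contra hne
    wlog hlt : m < n generalizing m n
    · exact this hmn.symm h.symm (Ne.symm hne) (lt_of_le_of_ne (not_lt.1 hlt) (Ne.symm hne))
    refine hmove t₁ ht₁ ht₁1 (smul_eq_self_of_pow_smul_eq (n := n - m) (by omega) ?_)
    rw [pow_sub _ hlt.le, h, mul_inv_cancel, one_smul]
  exact ⟨intCyclicMulEquiv.symm⟩

end Core

/-! ### The cyclic base of a restricted wreath product -/

section Wreath

variable {C T : Type*} [Group C] [Group T]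

/-- The top group `T` of the restricted wreath product. -/
def RestrictedWreathProduct.inr : T →* RestrictedWreathProduct C T :=
  (RegularWreathProduct.inl (D := C)).codRestrict (restrictedWreathSubgroup C T) fun _ =>
    Set.Finite.subset Set.finite_empty (by simp [RegularWreathProduct.left_inl])

/-- The finitely supported functions from `T` to the cyclic group generated by `c`. They form an
abelian subgroup of the base of `C ≀ T` which is normalized by `T`. -/
def cyclicBase (T : Type*) [Group T] (c : C) : Subgroup (RestrictedWreathProduct C T) where
  carrier := {b | b.1.right = 1 ∧ ∀ x, b.1.left x ∈ Subgroup.zpowers c}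
  one_mem' := ⟨rfl, fun _ => Subgroup.one_mem _⟩
  mul_mem' := fun {a b} ha hb =>
    ⟨by rw [Subgroup.coe_mul, RegularWreathProduct.mul_right, ha.1, hb.1, mul_one],
      fun x => Subgroup.mul_mem _ (ha.2 x) (hb.2 _)⟩
  inv_mem' := fun {a} ha =>
    ⟨by rw [Subgroup.coe_inv, RegularWreathProduct.inv_right, ha.1, inv_one],
      fun x => Subgroup.inv_mem _ (ha.2 _)⟩

theorem RestrictedWreathProduct.ext_left_right {a b : RestrictedWreathProduct C T}
    (h : ∀ x, a.1.left x = b.1.left x) (h' : a.1.right = b.1.right) : a = b :=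
  Subtype.ext (RegularWreathProduct.ext (funext h) h')

theorem cyclicBase_mul_comm {c : C} {a b : RestrictedWreathProduct C T}
    (ha : a ∈ cyclicBase T c) (hb : b ∈ cyclicBase T c) : a * b = b * a := by
  refine RestrictedWreathProduct.ext_left_right (fun x => ?_) ?_
  · change a.1.left x * b.1.left (a.1.right⁻¹ * x) = b.1.left x * a.1.left (b.1.right⁻¹ * x)
    obtain ⟨m, hm⟩ := Subgroup.mem_zpowers_iff.1 (ha.2 x)
    obtain ⟨n, hn⟩ := Subgroup.mem_zpowers_iff.1 (hb.2 x)
    rw [ha.1, hb.1, inv_one, one_mul, ← hm, ← hn, ← zpow_add, ← zpow_add, add_comm]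
  · change a.1.right * b.1.right = b.1.right * a.1.right
    rw [ha.1, hb.1]

theorem left_conj_inr (t : T) (b : RestrictedWreathProduct C T) (x : T) :
    (RestrictedWreathProduct.inr t * b * (RestrictedWreathProduct.inr t)⁻¹).1.left x =
      b.1.left (t⁻¹ * x) := by
  change 1 * b.1.left (t⁻¹ * x) * (1 : C)⁻¹ = _
  rw [one_mul, inv_one, mul_one]

theorem conj_inr_mem_cyclicBase {c : C} (t : T) {b : RestrictedWreathProduct C T}
    (hb : b ∈ cyclicBase T c) :
    RestrictedWreathProduct.inr t * b * (RestrictedWreathProduct.inr t)⁻¹ ∈ cyclicBase T c := by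
  refine ⟨?_, fun x => ?_⟩
  · change t * b.1.right * t⁻¹ = 1
    rw [hb.1, mul_one, mul_inv_cancel]
  · rw [left_conj_inr]; exact hb.2 _

/-- An element of infinite order moves every nonempty finite support. -/
theorem eq_one_of_conj_inr_eq {c : C} {t : T} (ht : ∀ n : ℕ, n ≠ 0 → t ^ n ≠ 1)
    {b : RestrictedWreathProduct C T} (hb : b ∈ cyclicBase T c)
    (h : RestrictedWreathProduct.inr t * b * (RestrictedWreathProduct.inr t)⁻¹ = b) : b = 1 := by
  refine RestrictedWreathProduct.ext_left_right (fun x => ?_) hb.1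
  by_contra hx
  have hinv : ∀ n : ℕ, b.1.left (t ^ n * x) = b.1.left x := by
    intro n
    induction n with
    | zero => simp
    | succ n ih =>
      rw [← ih, pow_succ', mul_assoc, ← h, left_conj_inr, inv_mul_cancel_left, h]
  have hfin : (Function.mulSupport b.1.left).Finite := b.2
  obtain ⟨m, -, n, -, hne, he⟩ := Set.infinite_univ.exists_ne_map_eq_of_mapsTo
    (f := fun n : ℕ => t ^ n * x) (t := Function.mulSupport b.1.left)
    (fun n _ => by rw [Function.mem_mulSupport, hinv]; exact hx) hfin
  have he' : t ^ m = t ^ n := mul_right_cancel he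
  wlog hlt : m < n generalizing m n
  · exact this n m hne.symm he.symm he'.symm (lt_of_le_of_ne (not_lt.1 hlt) hne.symm)
  refine ht (n - m) (by omega) ?_
  rw [pow_sub _ hlt.le, he', mul_inv_cancel]

theorem RestrictedWreathProduct.exists_mem_cyclicBase_ne_one {c : C} (hc : c ≠ 1) :
    ∃ b ∈ cyclicBase T c, b ≠ 1 := by
  classical
  refine ⟨⟨⟨Pi.mulSingle 1 c, 1⟩, (Set.finite_singleton (1 : T)).subset
    Pi.mulSupport_mulSingle_subset⟩, ⟨rfl, fun x => ?_⟩, fun h => hc ?_⟩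
  · change Pi.mulSingle (M := fun _ => C) (1 : T) c x ∈ _
    by_cases hx : x = 1
    · subst hx; rw [Pi.mulSingle_eq_same]; exact Subgroup.mem_zpowers c
    · rw [Pi.mulSingle_eq_of_ne hx]; exact Subgroup.one_mem _
  · have := congrArg (fun b : RestrictedWreathProduct C T => b.1.left 1) h
    simpa using this

end Wreath

/-! ### Wreath products among piecewise-linear homeomorphisms -/

theorem theorem1p2 {C T : Type*} [Group C] [Group T] [Nontrivial C] [Nontrivial T]
    (H : Subgroup PLo) (hH : Nonempty (H ≃* RestrictedWreathProduct C T)) :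
    Nonempty (T ≃* Multiplicative ℤ) := by
  obtain ⟨e⟩ := hH
  let ψ : RestrictedWreathProduct C T →* PLo := H.subtype.comp e.symm.toMonoidHom
  have hψ : Function.Injective ψ := H.subtype_injective.comp e.symm.injective
  let τ : T →* PLo := ψ.comp RestrictedWreathProduct.inr
  have hτ : Function.Injective τ := hψ.comp fun s t h =>
    congrArg (fun b : RestrictedWreathProduct C T => b.1.right) h
  obtain ⟨c, hc⟩ := exists_ne (1 : C)
  obtain ⟨b, hb, hb1⟩ := RestrictedWreathProduct.exists_mem_cyclicBase_ne_one (T := T) hc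
  have hA : ∀ b ∈ (cyclicBase T c).map ψ, ∀ b' ∈ (cyclicBase T c).map ψ, Commute b b' := by
    rintro _ ⟨b, hb, rfl⟩ _ ⟨b', hb', rfl⟩
    exact (show Commute b b' from cyclicBase_mul_comm hb hb').map ψ
  have hT : ∀ t ∈ τ.range, ∀ b ∈ (cyclicBase T c).map ψ, t * b * t⁻¹ ∈ (cyclicBase T c).map ψ := by
    rintro _ ⟨t, rfl⟩ _ ⟨b, hb, rfl⟩
    exact ⟨_, conj_inr_mem_cyclicBase t hb, by simp [τ]⟩
  have hfree : ∀ t ∈ τ.range, ∀ b ∈ (cyclicBase T c).map ψ, t * b * t⁻¹ = b → t = 1 ∨ b = 1 := by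
    rintro _ ⟨t, rfl⟩ _ ⟨b, hb, rfl⟩ h
    refine or_iff_not_imp_left.2 fun ht => ?_
    have hord : ∀ n : ℕ, n ≠ 0 → t ^ n ≠ 1 := fun n hn htn =>
      ht (PLo.eq_one_of_pow_eq_one hn (by rw [← map_pow, htn, map_one]))
    rw [eq_one_of_conj_inr_eq hord hb (hψ (by simpa [τ] using h)), map_one]
  obtain ⟨hcomm, y, hy, hwand⟩ := exists_wandering_orbital hA hT hfree
    (Subgroup.mem_map_of_mem ψ hb) fun h => hb1 (hψ (h.trans (map_one ψ).symm))
  obtain ⟨t, ht⟩ := exists_ne (1 : T)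
  obtain ⟨f⟩ := nonempty_mulEquiv_int_of_wandering hcomm hy hwand
    ⟨τ t, ⟨t, rfl⟩, fun h => ht (hτ (h.trans (map_one τ).symm))⟩
  exact ⟨(MonoidHom.ofInjective hτ).trans f⟩
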